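/- Let $\mathcal{C}$ be a bicategory. **Bifactorization systems.** For 1-cells $f:A\to B$ and $g:X\to D$ write $f\perp g$ if the square of hom-categories $$\begin{array}{ccc}\mathcal{C}[B,X]&\to&\mathcal{C}[A,X]\\ \downarrow&&\downarrow\\ \mathcal{C}[B,D]&\to&\mathcal{C}[A,D]\end{array}$$ given by composition with $f$ and $g$ is a bipullback in $\mathbf{Cat}$. A *bifactorization system* $(\mathcal{L},\mathcal{R})$ on $\mathcal{C}$ consists of two classes of 1-cells such that $\mathcal{L}={}^{\perp}\mathcal{R}$, $\mathcal{R}=\mathcal{L}^{\perp}$, and every 1-cell $f$ admits an invertible 2-cell $r_f l_f\simeq f$ with $l_f\in\mathcal{L}$, $r_f\in\mathcal{R}$, where for any other such factorization $r l\simeq f$ there are an equivalence $i$ and invertible 2-cells $i l\simeq l_f$, $r\simeq r_f i$ pasting to the given 2-cells, and these data are unique up to a unique compatible invertible 2-cell. A subclass $\mathcal{L}'\subseteq\mathcal{L}$ has *right cancellation along $\mathcal{L}$-maps* if, for every invertible 2-cell $f l\simeq a$ with $a\in\mathcal{L}'$ and $l\in\mathcal{L}$, one has $f\in\mathcal{L}'$.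 **Bistable pseudofunctors.** Let $U:\mathcal{A}\to\mathcal{B}$ be a pseudofunctor. A 1-cell $n:B\to U(A)$ is *$U$-generic* if: (i) for all $f:B\to U(A_1)$, $u:A_1\to A_2$, $v:A\to A_2$ and every invertible $\alpha:U(u)f\simeq U(v)n$ there are a 1-cell $w:A\to A_1$ and invertible 2-cells $\nu:U(w)n\simeq f$ in $\mathcal{B}$ and $\omega:uw\simeq v$ in $\mathcal{A}$ such that pasting $\nu$ and $U(\omega)$ gives $\alpha$, and such a *filler* $(w,\nu,\omega)$ is unique up to a unique invertible 2-cell compatible with $\nu$ and $\omega$; (ii) for $\alpha_1:U(u)f_1\simeq U(v)n$, $\alpha_2:U(u)f_2\simeq U(v)n$ and any (not necessarily invertible) 2-cell $\phi:f_1\Rightarrow f_2$ with $\alpha_2\cdot(U(u)\phi)=\alpha_1$, and for fillers $(w_i,\nu_i,\omega_i)$ of $\alpha_i$, there is a unique 2-cell $\sigma:w_1\Rightarrow w_2$ with $\omega_2\cdot(u\sigma)=\omega_1$ and $\nu_2\cdot(U(\sigma)n)=\phi\cdot\nu_1$. The pseudofunctor $U$ is *bistable* if every 1-cell $f:B\to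 U(A)$ admits an invertible 2-cell $\alpha_f:U(u_f)n_f\simeq f$ with $n_f:B\to U(A_f)$ generic and $u_f:A_f\to A$ in $\mathcal{A}$, such that for any other $\alpha:U(u)n\simeq f$ with $n:B\to U(A')$ generic there are an equivalence $e:A'\to A_f$ and invertible 2-cells $\nu:U(e)n\simeq n_f$, $\omega:u_f e\simeq u$ whose pasting with $\alpha_f$ is $\alpha$, the data $(e,\nu,\omega)$ being unique up to a unique compatible invertible 2-cell. **Left objects.** For an object $C$, the pseudoslice $\mathcal{C}/C$ has as 0-cells the 1-cells $a:A\to C$, as 1-cells $a\to b$ the pairs $(u,\alpha)$ with $\alpha:bu\simeq a$ invertible, and as 2-cells $(u,\alpha)\Rightarrow(u',\alpha')$ the 2-cells $\phi:u\Rightarrow u'$ with $\alpha=\alpha'\cdot(b\phi)$. Let $\mathcal{L}'\text{-}\mathbf{Obj}_C^{\mathcal{L}_C}$ be the sub-bicategory of $\mathcal{C}/C$ on the 0-cells $a\in\mathcal{L}'$, the 1-cells $(l,\lambda)$ with $l\in\mathcal{L}$, and all 2-cells between them. If $\mathcal{C}$ has a biterminal object $1$ (each $\mathcal{C}[X,1]$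 is equivalent to the terminal category), let $\mathcal{L}'\text{-}\mathbf{Obj}^{\mathcal{L}}$ be the sub-bicategory of $\mathcal{C}$ on the objects whose map to $1$ is in $\mathcal{L}'$, with all $\mathcal{L}$-maps between them and all 2-cells between these. Write $(-)^{\mathrm{op}}$ for the dual reversing 1-cells. **Theorem.** Let $(\mathcal{L},\mathcal{R})$ be a bifactorization system on a bicategory $\mathcal{C}$ and let $\mathcal{L}'\subseteq\mathcal{L}$ have right cancellation along $\mathcal{L}$-maps. Then: 1. if $\mathcal{C}$ has a biterminal object and $\mathcal{L}'$ contains all identities, the inclusion $(\mathcal{L}'\text{-}\mathbf{Obj}^{\mathcal{L}})^{\mathrm{op}}\hookrightarrow\mathcal{C}^{\mathrm{op}}$ is bistable; 2. for each object $C$ of $\mathcal{C}$, the inclusion $(\mathcal{L}'\text{-}\mathbf{Obj}_C^{\mathcal{L}_C})^{\mathrm{op}}\hookrightarrow(\mathcal{C}/C)^{\mathrm{op}}$ is bistable. -/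

import Mathlib

open CategoryTheory Bicategory Opposite

universe w v u w₁ v₁ u₁ w₂ v₂ u₂

namespace BiStab

section Basic

variable {C : Type u} [Bicategory.{w, v} C]

/-- A 1-cell is an equivalence if it has an inverse up to invertible 2-cells. -/
def IsEquiv {X Y : C} (e : X ⟶ Y) : Prop :=
  ∃ e' : Y ⟶ X, Nonempty (e ≫ e' ≅ 𝟙 X) ∧ Nonempty (e' ≫ e ≅ 𝟙 Y)

/-- `T` is biterminal if every hom-category into `T` is equivalent to the terminal category. -/
def IsBiterminal (T : C) : Prop :=
  ∀ X : C, Nonempty ((X ⟶ T) ≌ Discrete PUnit.{1})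

/-! ### Bi-orthogonality -/

/-- The comparison functor from `C[B, X]` to the category of pseudocommutative squares from
`f : A ⟶ B` to `g : X ⟶ D`, i.e. the (pseudo)pullback of `C[A, g]` and `C[f, D]`. It sends `s` to
`(f ≫ s, s ≫ g)` together with the associator. -/
def fillerFunctor {A B X D : C} (f : A ⟶ B) (g : X ⟶ D) :
    (B ⟶ X) ⥤ Limits.CategoricalPullback (postcomp A g) (precomp D f) where
  obj s := { fst := f ≫ s, snd := s ≫ g, iso := α_ f s g }
  map σ := { fst := f ◁ σ, snd := σ ▷ g, w := associator_naturality_middle f σ g }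

/-- `f` is left bi-orthogonal to `g`: the square of hom-categories
`C[B, X] → C[A, X] ×_{C[A, D]} C[B, D]` is a bipullback in `Cat`. -/
def BiOrthogonal {A B X D : C} (f : A ⟶ B) (g : X ⟶ D) : Prop :=
  (fillerFunctor f g).IsEquivalence

theorem BiOrthogonal.exists_filler {A B X D : C} {f : A ⟶ B} {g : X ⟶ D}
    (h : BiOrthogonal f g) (p : A ⟶ X) (q : B ⟶ D) (e : p ≫ g ≅ f ≫ q) :
    ∃ (s : B ⟶ X) (l : f ≫ s ≅ p) (r : s ≫ g ≅ q),
      l.hom ▷ g ≫ e.hom = (α_ f s g).hom ≫ f ◁ r.hom := by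
  have : (fillerFunctor f g).IsEquivalence := h
  let S : Limits.CategoricalPullback (postcomp A g) (precomp D f) := ⟨p, q, e⟩
  let i := (fillerFunctor f g).objObjPreimageIso S
  refine ⟨(fillerFunctor f g).objPreimage S,
    (Limits.CategoricalPullback.π₁ _ _).mapIso i,
    (Limits.CategoricalPullback.π₂ _ _).mapIso i, i.hom.w⟩

theorem BiOrthogonal.exists_cell {A B X D : C} {f : A ⟶ B} {g : X ⟶ D}
    (h : BiOrthogonal f g) {s t : B ⟶ X} (φ : f ≫ s ⟶ f ≫ t) (ψ : s ≫ g ⟶ t ≫ g)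
    (e : φ ▷ g ≫ (α_ f t g).hom = (α_ f s g).hom ≫ f ◁ ψ) :
    ∃ σ : s ⟶ t, f ◁ σ = φ ∧ σ ▷ g = ψ := by
  have : (fillerFunctor f g).IsEquivalence := h
  let m : (fillerFunctor f g).obj s ⟶ (fillerFunctor f g).obj t := ⟨φ, ψ, e⟩
  refine ⟨(fillerFunctor f g).preimage m, ?_, ?_⟩
  · exact congrArg Limits.CategoricalPullback.Hom.fst ((fillerFunctor f g).map_preimage m)
  · exact congrArg Limits.CategoricalPullback.Hom.snd ((fillerFunctor f g).map_preimage m)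

theorem BiOrthogonal.cell_ext {A B X D : C} {f : A ⟶ B} {g : X ⟶ D}
    (h : BiOrthogonal f g) {s t : B ⟶ X} {σ τ : s ⟶ t} (h₁ : f ◁ σ = f ◁ τ)
    (h₂ : σ ▷ g = τ ▷ g) : σ = τ := by
  have : (fillerFunctor f g).IsEquivalence := h
  exact (fillerFunctor f g).map_injective (Limits.CategoricalPullback.Hom.ext h₁ h₂)

theorem BiOrthogonal.mk {A B X D : C} {f : A ⟶ B} {g : X ⟶ D}
    (h₁ : ∀ (p : A ⟶ X) (q : B ⟶ D) (e : p ≫ g ≅ f ≫ q),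
      ∃ (s : B ⟶ X) (l : f ≫ s ≅ p) (r : s ≫ g ≅ q),
        l.hom ▷ g ≫ e.hom = (α_ f s g).hom ≫ f ◁ r.hom)
    (h₂ : ∀ (s t : B ⟶ X) (φ : f ≫ s ⟶ f ≫ t) (ψ : s ≫ g ⟶ t ≫ g),
      φ ▷ g ≫ (α_ f t g).hom = (α_ f s g).hom ≫ f ◁ ψ →
        ∃ σ : s ⟶ t, f ◁ σ = φ ∧ σ ▷ g = ψ)
    (h₃ : ∀ (s t : B ⟶ X) (σ τ : s ⟶ t), f ◁ σ = f ◁ τ → σ ▷ g = τ ▷ g → σ = τ) :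
    BiOrthogonal f g where
  faithful := ⟨fun {s t σ τ} h => h₃ s t σ τ
    (congrArg Limits.CategoricalPullback.Hom.fst h)
    (congrArg Limits.CategoricalPullback.Hom.snd h)⟩
  full := ⟨fun {s t} m => by
    obtain ⟨σ, hσ₁, hσ₂⟩ := h₂ s t m.fst m.snd m.w
    exact ⟨σ, Limits.CategoricalPullback.Hom.ext hσ₁ hσ₂⟩⟩
  essSurj := ⟨fun S => by
    obtain ⟨s, l, r, h⟩ := h₁ S.fst S.snd S.iso
    exact ⟨s, ⟨Limits.CategoricalPullback.mkIso l r h⟩⟩⟩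

theorem BiOrthogonal.id_left (A : C) {X D : C} (g : X ⟶ D) : BiOrthogonal (𝟙 A) g := by
  refine BiOrthogonal.mk ?_ ?_ ?_
  · intro p q e
    exact ⟨p, λ_ p, e ≪≫ λ_ q, by simp⟩
  · intro s t φ ψ e
    have key : 𝟙 A ◁ ((λ_ s).inv ≫ φ ≫ (λ_ t).hom) = φ := by simp
    refine ⟨(λ_ s).inv ≫ φ ≫ (λ_ t).hom, key, ?_⟩
    have h : 𝟙 A ◁ (((λ_ s).inv ≫ φ ≫ (λ_ t).hom) ▷ g) = 𝟙 A ◁ ψ := by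
      rw [← cancel_epi (α_ (𝟙 A) s g).hom, ← e, ← associator_naturality_middle, key]
    simpa only [id_whiskerLeft, cancel_epi, cancel_mono] using h
  · intro s t σ τ h _
    simpa only [id_whiskerLeft, cancel_epi, cancel_mono] using h

theorem BiOrthogonal.comp_left {A A' B X D : C} {f₁ : A ⟶ A'} {f₂ : A' ⟶ B} {g : X ⟶ D}
    (h₁ : BiOrthogonal f₁ g) (h₂ : BiOrthogonal f₂ g) : BiOrthogonal (f₁ ≫ f₂) g := by
  refine BiOrthogonal.mk ?_ ?_ ?_
  · intro p q e
    obtain ⟨s₁, l₁, r₁, e₁⟩ := h₁.exists_filler p (f₂ ≫ q) (e ≪≫ α_ f₁ f₂ q)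
    obtain ⟨s, l, r, e₂⟩ := h₂.exists_filler s₁ q r₁
    refine ⟨s, α_ f₁ f₂ s ≪≫ whiskerLeftIso f₁ l ≪≫ l₁, r, ?_⟩
    have e₁' : l₁.hom ▷ g ≫ e.hom = (α_ f₁ s₁ g).hom ≫ f₁ ◁ r₁.hom ≫ (α_ f₁ f₂ q).inv := by
      rw [← cancel_mono (α_ f₁ f₂ q).hom]
      simpa using e₁
    simp only [Iso.trans_hom, whiskerLeftIso_hom, comp_whiskerRight, Category.assoc]
    rw [e₁', associator_naturality_middle_assoc, ← whiskerLeft_comp_assoc, e₂]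
    simp
  · intro s t φ ψ e
    obtain ⟨σ₁, a, b⟩ := h₁.exists_cell (s := f₂ ≫ s) (t := f₂ ≫ t)
      ((α_ f₁ f₂ s).inv ≫ φ ≫ (α_ f₁ f₂ t).hom)
      ((α_ f₂ s g).hom ≫ f₂ ◁ ψ ≫ (α_ f₂ t g).inv) (by
        have e' : φ ▷ g = (α_ (f₁ ≫ f₂) s g).hom ≫ (f₁ ≫ f₂) ◁ ψ ≫ (α_ (f₁ ≫ f₂) t g).inv := by
          rw [← cancel_mono (α_ (f₁ ≫ f₂) t g).hom]
          simpa using e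
        simp [e'])
    obtain ⟨σ, c, d⟩ := h₂.exists_cell σ₁ ψ (by rw [b]; simp)
    exact ⟨σ, by rw [comp_whiskerLeft, c, a]; simp, d⟩
  · intro s t σ τ a b
    refine h₂.cell_ext (h₁.cell_ext ?_ ?_) b
    · simpa only [comp_whiskerLeft, cancel_epi, cancel_mono] using a
    · simp [b]

/-! ### Bifactorization systems -/

/-- An equivalence between two factorizations `r' ∘ l' ≃ f` (via `β`) and `r ∘ l ≃ f` (via `α`):
an equivalence `i` between the middle objects, with invertible 2-cells `lam : i ∘ l' ≃ l` and
`rho : r' ≃ r ∘ i` whose pasting with `α` is `β`. -/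
structure FactEquiv {A B X X' : C} {f : A ⟶ B} {l : A ⟶ X} {r : X ⟶ B} (α : l ≫ r ≅ f)
    {l' : A ⟶ X'} {r' : X' ⟶ B} (β : l' ≫ r' ≅ f) where
  i : X' ⟶ X
  isEquiv : IsEquiv i
  lam : l' ≫ i ≅ l
  rho : r' ≅ i ≫ r
  w : β.hom = l' ◁ rho.hom ≫ (α_ l' i r).inv ≫ lam.hom ▷ r ≫ α.hom

/-- `(L, R)` is a bifactorization system: each class is the bi-orthogonal of the other, and every
1-cell has an `(L, R)`-factorization up to an invertible 2-cell, unique up to an equivalence which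
is itself unique up to a unique invertible 2-cell. -/
structure IsBifactorizationSystem (L R : MorphismProperty C) : Prop where
  left_iff : ∀ {A B : C} (f : A ⟶ B),
    L f ↔ ∀ ⦃X D : C⦄ (g : X ⟶ D), R g → BiOrthogonal f g
  right_iff : ∀ {X D : C} (g : X ⟶ D),
    R g ↔ ∀ ⦃A B : C⦄ (f : A ⟶ B), L f → BiOrthogonal f g
  factorization : ∀ {A B : C} (f : A ⟶ B),
    ∃ (X : C) (l : A ⟶ X) (r : X ⟶ B) (α : l ≫ r ≅ f), L l ∧ R r ∧
      ∀ (X' : C) (l' : A ⟶ X') (r' : X' ⟶ B) (β : l' ≫ r' ≅ f), L l' → R r' →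
        Nonempty (FactEquiv α β) ∧
        ∀ c d : FactEquiv α β, ∃! σ : c.i ≅ d.i,
          l' ◁ σ.hom ≫ d.lam.hom = c.lam.hom ∧ c.rho.hom ≫ σ.hom ▷ r = d.rho.hom

theorem IsBifactorizationSystem.id_mem {L R : MorphismProperty C}
    (h : IsBifactorizationSystem L R) (X : C) : L (𝟙 X) :=
  (h.left_iff _).2 fun _ _ g _ => BiOrthogonal.id_left X g

theorem IsBifactorizationSystem.comp_mem {L R : MorphismProperty C}
    (h : IsBifactorizationSystem L R) {X Y Z : C} (f : X ⟶ Y) (g : Y ⟶ Z) (hf : L f)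
    (hg : L g) : L (f ≫ g) :=
  (h.left_iff _).2 fun _ _ k hk =>
    BiOrthogonal.comp_left ((h.left_iff f).1 hf k hk) ((h.left_iff g).1 hg k hk)

/-- `L'` has right cancellation along `L`-maps: if `f ∘ l ≃ a` with `a` in `L'` and `l` in `L`,
then `f` is in `L'`. -/
def HasRightCancellationAlong (L' L : MorphismProperty C) : Prop :=
  ∀ ⦃A B X : C⦄ (l : A ⟶ B) (f : B ⟶ X) (a : A ⟶ X),
    Nonempty (l ≫ f ≅ a) → L' a → L l → L' f

end Basic

/-! ### Locally full sub-bicategories -/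

/-- A class of 0-cells and a class of 1-cells, the latter containing identities and closed under
composition. It determines a sub-bicategory with all 2-cells between the selected 1-cells. -/
structure SubData (C : Type u) [Bicategory.{w, v} C] where
  objProp : C → Prop
  homProp : MorphismProperty C
  id_mem : ∀ X : C, homProp (𝟙 X)
  comp_mem : ∀ {X Y Z : C} (f : X ⟶ Y) (g : Y ⟶ Z), homProp f → homProp g → homProp (f ≫ g)

section Sub

variable {C : Type u} [Bicategory.{w, v} C]

/-- The 0-cells of the sub-bicategory. -/
structure Sub (S : SubData C) where
  obj : C
  property : S.objProp obj

namespace Sub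

variable {S : SubData C}

/-- The 1-cells of the sub-bicategory. -/
structure Hom (X Y : Sub S) where
  hom : X.obj ⟶ Y.obj
  property : S.homProp hom

@[simps]
instance : CategoryStruct (Sub S) where
  Hom X Y := Hom X Y
  id X := ⟨𝟙 X.obj, S.id_mem _⟩
  comp f g := ⟨f.hom ≫ g.hom, S.comp_mem _ _ f.property g.property⟩

/-- The 2-cells of the sub-bicategory. -/
@[ext]
structure Hom₂ {X Y : Sub S} (f g : X ⟶ Y) where
  cell : Hom.hom f ⟶ Hom.hom g

@[simps]
instance homCategory (X Y : Sub S) : Category (X ⟶ Y) where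
  Hom f g := Hom₂ f g
  id f := ⟨𝟙 (Hom.hom f)⟩
  comp η θ := ⟨η.cell ≫ θ.cell⟩

@[ext]
theorem hom₂_ext {X Y : Sub S} {f g : X ⟶ Y} {η θ : f ⟶ g} (h : η.cell = θ.cell) : η = θ :=
  Hom₂.ext h

/-- An invertible 2-cell between selected 1-cells is invertible in the sub-bicategory. -/
@[simps]
def isoMk {X Y : Sub S} {f g : X ⟶ Y} (e : Hom.hom f ≅ Hom.hom g) : f ≅ g where
  hom := ⟨e.hom⟩
  inv := ⟨e.inv⟩

instance bicategory : Bicategory (Sub S) where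
  homCategory := homCategory
  whiskerLeft f _ _ η := ⟨Hom.hom f ◁ η.cell⟩
  whiskerRight η h := ⟨η.cell ▷ Hom.hom h⟩
  associator f g h := isoMk (α_ (Hom.hom f) (Hom.hom g) (Hom.hom h))
  leftUnitor f := isoMk (λ_ (Hom.hom f))
  rightUnitor f := isoMk (ρ_ (Hom.hom f))
  whisker_exchange η θ := Hom₂.ext (whisker_exchange η.cell θ.cell)

variable (S)

/-- The inclusion of the sub-bicategory. -/
def incl : Pseudofunctor (Sub S) C where
  obj X := X.obj
  map f := Hom.hom f
  map₂ η := η.cell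
  mapId X := Iso.refl _
  mapComp f g := Iso.refl _

end Sub

end Sub

/-! ### Pseudoslices -/

section Slice

variable {C : Type u} [Bicategory.{w, v} C]

/-- The 0-cells of the pseudoslice over `X`: 1-cells with codomain `X`. -/
structure PseudoSlice (X : C) where
  dom : C
  str : dom ⟶ X

namespace PseudoSlice

variable {X : C}

/-- The 1-cells of the pseudoslice: triangles filled by an invertible 2-cell. -/
structure Hom (a b : PseudoSlice X) where
  hom : a.dom ⟶ b.dom
  iso : hom ≫ b.str ≅ a.str

@[simps]
instance : CategoryStruct (PseudoSlice X) where
  Hom a b := Hom a b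
  id a := ⟨𝟙 a.dom, λ_ a.str⟩
  comp {_ _ c} f g :=
    ⟨f.hom ≫ g.hom, α_ f.hom g.hom c.str ≪≫ whiskerLeftIso f.hom g.iso ≪≫ f.iso⟩

/-- The 2-cells of the pseudoslice: 2-cells compatible with the triangles. -/
@[ext]
structure Hom₂ {a b : PseudoSlice X} (f g : a ⟶ b) where
  cell : Hom.hom f ⟶ Hom.hom g
  w : cell ▷ b.str ≫ (Hom.iso g).hom = (Hom.iso f).hom

@[simps]
instance homCategory (a b : PseudoSlice X) : Category (a ⟶ b) where
  Hom f g := Hom₂ f g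
  id f := ⟨𝟙 (Hom.hom f), by simp⟩
  comp η θ := ⟨η.cell ≫ θ.cell, by rw [comp_whiskerRight, Category.assoc, θ.w, η.w]⟩

@[ext]
theorem hom₂_ext {a b : PseudoSlice X} {f g : a ⟶ b} {η θ : f ⟶ g} (h : η.cell = θ.cell) :
    η = θ :=
  Hom₂.ext h

/-- An invertible 2-cell compatible with the triangles is invertible in the pseudoslice. -/
@[simps]
def isoMk {a b : PseudoSlice X} {f g : a ⟶ b} (e : Hom.hom f ≅ Hom.hom g)
    (w : e.hom ▷ b.str ≫ (Hom.iso g).hom = (Hom.iso f).hom) : f ≅ g where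
  hom := ⟨e.hom, w⟩
  inv := ⟨e.inv, by rw [← w]; simp⟩

instance bicategory : Bicategory (PseudoSlice X) where
  homCategory := homCategory
  whiskerLeft {_ _ c} f g h η := ⟨Hom.hom f ◁ η.cell, by
    simp [← η.w]⟩
  whiskerRight {_ _ c f g} η h := ⟨η.cell ▷ Hom.hom h, by
    simp [← η.w, whisker_exchange_assoc]⟩
  associator f g h := isoMk (α_ (Hom.hom f) (Hom.hom g) (Hom.hom h)) (by simp)
  leftUnitor f := isoMk (λ_ (Hom.hom f)) (by simp)
  rightUnitor f := isoMk (ρ_ (Hom.hom f)) (by simp)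
  whisker_exchange η θ := Hom₂.ext (whisker_exchange η.cell θ.cell)

end PseudoSlice

end Slice

/-! ### Opposite pseudofunctor -/

section Op

variable {A : Type u₁} [Bicategory.{w₁, v₁} A] {B : Type u₂} [Bicategory.{w₂, v₂} B]

/-- The pseudofunctor between 1-cell duals induced by a pseudofunctor. -/
def opPseudofunctor (F : Pseudofunctor A B) : Pseudofunctor Aᵒᵖ Bᵒᵖ where
  obj X := op (F.obj X.unop)
  map f := (F.map f.unop).op
  map₂ η := Opposite.op2 (F.map₂ η.unop2)
  map₂_id f := congrArg Opposite.op2 (F.map₂_id f.unop)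
  map₂_comp η θ := congrArg Opposite.op2 (F.map₂_comp η.unop2 θ.unop2)
  mapId X := (F.mapId X.unop).op2
  mapComp f g := (F.mapComp g.unop f.unop).op2
  map₂_whisker_left f _ _ η := congrArg Opposite.op2 (F.map₂_whisker_right η.unop2 f.unop)
  map₂_whisker_right η h := congrArg Opposite.op2 (F.map₂_whisker_left h.unop η.unop2)
  map₂_associator f g h := congrArg Opposite.op2 (by
    change F.map₂ (α_ h.unop g.unop f.unop).inv = (F.mapComp h.unop (g.unop ≫ f.unop)).hom ≫
      F.map h.unop ◁ (F.mapComp g.unop f.unop).hom ≫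
        (α_ (F.map h.unop) (F.map g.unop) (F.map f.unop)).inv ≫
          (F.mapComp h.unop g.unop).inv ▷ F.map f.unop ≫ (F.mapComp (h.unop ≫ g.unop) f.unop).inv
    rw [← F.map₂Iso_inv, ← cancel_epi (F.map₂Iso (α_ h.unop g.unop f.unop)).hom,
      Iso.hom_inv_id]
    simp)
  map₂_left_unitor f := congrArg Opposite.op2 (F.map₂_right_unitor f.unop)
  map₂_right_unitor f := congrArg Opposite.op2 (F.map₂_left_unitor f.unop)

end Op

/-! ### Generic 1-cells and bistable pseudofunctors -/

section Bistable

variable {A : Type u₁} [Bicategory.{w₁, v₁} A] {B : Type u₂} [Bicategory.{w₂, v₂} B]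
variable (U : Pseudofunctor A B)

/-- A filler of the pseudosquare `α : U(u) ∘ f ≃ U(v) ∘ n`: a 1-cell `w` of `A` with invertible
2-cells `ν : U(w) ∘ n ≃ f` in `B` and `ω : u ∘ w ≃ v` in `A`, whose pasting is `α`. -/
structure Filler {b : B} {a a₁ a₂ : A} (n : b ⟶ U.obj a) {f : b ⟶ U.obj a₁} {u : a₁ ⟶ a₂}
    {v : a ⟶ a₂} (α : f ≫ U.map u ≅ n ≫ U.map v) where
  w : a ⟶ a₁
  ν : n ≫ U.map w ≅ f
  ω : w ≫ u ≅ v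
  paste : ν.hom ▷ U.map u ≫ α.hom =
    (α_ n (U.map w) (U.map u)).hom ≫ n ◁ ((U.mapComp w u).inv ≫ U.map₂ ω.hom)

/-- `n : b ⟶ U(a)` is `U`-generic: every pseudosquare from `n` to some `U(u)` has a filler, unique
up to a unique invertible 2-cell, and every morphism of pseudosquares `φ : f₁ ⟶ f₂` with fixed
bottom side `U(v)` induces a unique compatible 2-cell between the corresponding fillers. -/
structure IsGeneric {b : B} {a : A} (n : b ⟶ U.obj a) : Prop where
  exists_filler : ∀ {a₁ a₂ : A} (f : b ⟶ U.obj a₁) (u : a₁ ⟶ a₂) (v : a ⟶ a₂)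
    (α : f ≫ U.map u ≅ n ≫ U.map v), Nonempty (Filler U n α)
  filler_unique : ∀ {a₁ a₂ : A} (f : b ⟶ U.obj a₁) (u : a₁ ⟶ a₂) (v : a ⟶ a₂)
    (α : f ≫ U.map u ≅ n ≫ U.map v) (s t : Filler U n α),
    ∃! σ : s.w ≅ t.w, σ.hom ▷ u ≫ t.ω.hom = s.ω.hom ∧ n ◁ U.map₂ σ.hom ≫ t.ν.hom = s.ν.hom
  exists_unique_cell : ∀ {a₁ a₂ : A} (f₁ f₂ : b ⟶ U.obj a₁) (u : a₁ ⟶ a₂) (v : a ⟶ a₂)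
    (α₁ : f₁ ≫ U.map u ≅ n ≫ U.map v) (α₂ : f₂ ≫ U.map u ≅ n ≫ U.map v) (φ : f₁ ⟶ f₂),
    φ ▷ U.map u ≫ α₂.hom = α₁.hom →
    ∀ (s : Filler U n α₁) (t : Filler U n α₂),
      ∃! σ : s.w ⟶ t.w, σ ▷ u ≫ t.ω.hom = s.ω.hom ∧
        n ◁ U.map₂ σ ≫ t.ν.hom = s.ν.hom ≫ φ

/-- An equivalence between two factorizations of `f : b ⟶ U(a)`, namely `β : U(u') ∘ n' ≃ f` and
`α : U(u) ∘ n ≃ f`: an equivalence `e` of `A` between the middle objects, with invertible 2-cells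
`ν : U(e) ∘ n' ≃ n` in `B` and `ω : u ∘ e ≃ u'` in `A`, whose pasting with `α` is `β`. -/
structure GenericFactEquiv {b : B} {a m m' : A} {f : b ⟶ U.obj a} {n : b ⟶ U.obj m} {u : m ⟶ a}
    (α : n ≫ U.map u ≅ f) {n' : b ⟶ U.obj m'} {u' : m' ⟶ a} (β : n' ≫ U.map u' ≅ f) where
  e : m' ⟶ m
  isEquiv : IsEquiv e
  ν : n' ≫ U.map e ≅ n
  ω : e ≫ u ≅ u'
  paste : n' ◁ U.map₂ ω.hom ≫ β.hom = n' ◁ (U.mapComp e u).hom ≫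
    (α_ n' (U.map e) (U.map u)).inv ≫ ν.hom ▷ U.map u ≫ α.hom

/-- `U` is bistable: every `f : b ⟶ U(a)` factors, up to an invertible 2-cell, as a generic 1-cell
followed by a 1-cell in the range of `U`, and such a factorization is unique up to an equivalence
which is itself unique up to a unique invertible 2-cell. -/
def IsBistable : Prop :=
  ∀ {b : B} {a : A} (f : b ⟶ U.obj a),
    ∃ (m : A) (n : b ⟶ U.obj m) (u : m ⟶ a) (α : n ≫ U.map u ≅ f), IsGeneric U n ∧
      ∀ (m' : A) (n' : b ⟶ U.obj m') (u' : m' ⟶ a) (β : n' ≫ U.map u' ≅ f), IsGeneric U n' →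
        Nonempty (GenericFactEquiv U α β) ∧
        ∀ c d : GenericFactEquiv U α β, ∃! σ : c.e ≅ d.e,
          σ.hom ▷ u ≫ d.ω.hom = c.ω.hom ∧ n' ◁ U.map₂ σ.hom ≫ d.ν.hom = c.ν.hom

end Bistable

/-! ### The bicategories of specified left objects -/

section LeftObjects

variable {C : Type u} [Bicategory.{w, v} C] {L R : MorphismProperty C}

/-- The sub-bicategory of `C` of `L'`-objects, i.e. objects whose map to the biterminal object `T`
is in `L'`, with all `L`-maps between them and all 2-cells between these. -/
def leftObj (h : IsBifactorizationSystem L R) (L' : MorphismProperty C) (T : C) : SubData C where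
  objProp X := ∃ t : X ⟶ T, L' t
  homProp := L
  id_mem := h.id_mem
  comp_mem := h.comp_mem

/-- The sub-bicategory of the pseudoslice over `X` whose 0-cells are the `L'`-maps into `X`, with
all triangles whose top side is an `L`-map and all 2-cells between these. -/
def leftObjOver (h : IsBifactorizationSystem L R) (L' : MorphismProperty C) (X : C) :
    SubData (PseudoSlice X) where
  objProp a := L' a.str
  homProp _ _ f := L f.hom
  id_mem a := h.id_mem a.dom
  comp_mem f g hf hg := h.comp_mem f.hom g.hom hf hg

end LeftObjects

end BiStab

/-! Read in `C`, a 1-cell of the dual into an object of the sub-bicategory is a 1-cell `f : A ⟶ B`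
whose source is a left object. Factor it as `l ≫ r`, with `l` in `L` and `r` in `R`.

The middle object is again a left object: its structure map, precomposed with `l`, is isomorphic to
that of `A`, which is in `L'`, so right cancellation along `L` applies. Hence `l` lies in the
sub-bicategory.

The map `r` is generic for the dual: a square to be filled has some `u` in `L` on one side and `r`
on the other, so `BiOrthogonal` supplies the diagonal and the 2-cells. The diagonal `s` is itself in
`L`, because `u ≫ s` is isomorphic to an `L`-map and `L` is right cancellative
(`IsBifactorizationSystem.left_cancel`).

Uniqueness of generic factorizations is formal: two of them fill each other
(`isBistable_of_exists_generic`), so only the existence of (L, R)-factorizations is needed. For the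
pseudoslice, bi-orthogonality lifts from the underlying 1-cells (`PseudoSlice.biOrthogonal`). -/

namespace BiStab

/-! ### Bi-orthogonality and right cancellation of the left class -/

section Orthogonality

variable {C : Type u} [Bicategory.{w, v} C]

/-- Bi-orthogonality is invariant under invertible 2-cells. -/
theorem BiOrthogonal.of_iso {A B X D : C} {f f' : A ⟶ B} {g : X ⟶ D} (h : BiOrthogonal f g)
    (i : f ≅ f') : BiOrthogonal f' g := by
  refine BiOrthogonal.mk ?_ ?_ ?_
  · intro p q e
    obtain ⟨s, l, r, w⟩ := h.exists_filler p q (e ≪≫ whiskerRightIso i.symm q)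
    refine ⟨s, whiskerRightIso i.symm s ≪≫ l, r, ?_⟩
    have w' : l.hom ▷ g ≫ e.hom = (α_ f s g).hom ≫ f ◁ r.hom ≫ i.hom ▷ q := by
      rw [← cancel_mono (i.inv ▷ q)]
      simpa using w
    simp [w', whisker_exchange]
  · intro s t φ ψ e
    obtain ⟨σ, a, b⟩ := h.exists_cell (i.hom ▷ s ≫ φ ≫ i.inv ▷ t) ψ (by
      have e' : φ ▷ g = (α_ f' s g).hom ≫ f' ◁ ψ ≫ (α_ f' t g).inv := by
        rw [← cancel_mono (α_ f' t g).hom]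
        simpa using e
      rw [comp_whiskerRight, comp_whiskerRight, e']
      simp only [Category.assoc]
      rw [associator_naturality_left_assoc, ← whisker_exchange_assoc]
      simp)
    refine ⟨σ, ?_, b⟩
    rw [← cancel_epi (i.hom ▷ s), ← whisker_exchange, a]
    simp
  · intro s t σ τ a b
    refine h.cell_ext ?_ b
    rw [← cancel_mono (i.hom ▷ t), whisker_exchange, whisker_exchange, a]

/-- If `u` and `u ≫ f` are left bi-orthogonal to `g`, then so is `f`. -/
theorem BiOrthogonal.of_comp_left {A B E X D : C} {u : A ⟶ B} {f : B ⟶ E} {g : X ⟶ D}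
    (hu : BiOrthogonal u g) (huf : BiOrthogonal (u ≫ f) g) : BiOrthogonal f g := by
  refine BiOrthogonal.mk ?_ ?_ ?_
  · intro p q e
    -- The diagonal of the square precomposed with `u` is already the one sought; only the 2-cell `f
    -- ≫ s ≅ p` is missing, since `l` gives it merely after `u`.
    obtain ⟨s, l, r, w⟩ := huf.exists_filler (u ≫ p) q
      (α_ u p g ≪≫ whiskerLeftIso u e ≪≫ (α_ u f q).symm)
    have w' : l.hom ▷ g ≫ (α_ u p g).hom ≫ u ◁ e.hom =
        (α_ (u ≫ f) s g).hom ≫ (u ≫ f) ◁ r.hom ≫ (α_ u f q).hom := by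
      rw [← cancel_mono (α_ u f q).inv]
      simpa using w
    have w'' : l.inv ▷ g ≫ (α_ (u ≫ f) s g).hom ≫ (u ≫ f) ◁ r.hom ≫ (α_ u f q).hom =
        (α_ u p g).hom ≫ u ◁ e.hom := by
      rw [← w']
      simp
    -- Bi-orthogonality of `u` descends `l` along `u`: its whiskering with `g` is prescribed by `r`
    -- and `e`. The inverse `τ` arises in the same way.
    obtain ⟨σ, a, b⟩ := hu.exists_cell (s := f ≫ s) (t := p) ((α_ u f s).inv ≫ l.hom)
      ((α_ f s g).hom ≫ f ◁ r.hom ≫ e.inv) (by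
        rw [← cancel_mono (u ◁ e.hom)]
        simp [w'])
    obtain ⟨τ, c, d⟩ := hu.exists_cell (s := p) (t := f ≫ s) (l.inv ≫ (α_ u f s).hom)
      (e.hom ≫ f ◁ r.inv ≫ (α_ f s g).inv) (by
        rw [← cancel_mono (u ◁ (α_ f s g).hom), ← cancel_mono (u ◁ f ◁ r.hom)]
        simpa using w'')
    refine ⟨s, ⟨σ, τ, hu.cell_ext ?_ ?_, hu.cell_ext ?_ ?_⟩, r, ?_⟩
    · simp [a, c]
    · simp [b, d]
    · simp [a, c]
    · simp [b, d]
    · simp [b]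
  · intro s t φ ψ e
    have e' : φ ▷ g = (α_ f s g).hom ≫ f ◁ ψ ≫ (α_ f t g).inv := by
      rw [← cancel_mono (α_ f t g).hom]
      simpa using e
    obtain ⟨σ, a, b⟩ := huf.exists_cell ((α_ u f s).hom ≫ u ◁ φ ≫ (α_ u f t).inv) ψ (by
      simp [e'])
    -- `f ◁ σ` and `φ` agree after `u` by the choice of `σ`, and after `g` by the compatibility `e`.
    refine ⟨σ, hu.cell_ext ?_ ?_, b⟩
    · simpa only [comp_whiskerLeft, cancel_epi, cancel_mono] using a
    · rw [e', ← b]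
      simp
  · intro s t σ τ a b
    exact huf.cell_ext (by simp only [comp_whiskerLeft, a]) b

/-- The left class of a bifactorization system is right cancellative. -/
theorem IsBifactorizationSystem.left_cancel {L R : MorphismProperty C}
    (h : IsBifactorizationSystem L R) {X Y Z : C} {u : X ⟶ Y} {f : Y ⟶ Z} {v : X ⟶ Z}
    (i : u ≫ f ≅ v) (hu : L u) (hv : L v) : L f :=
  (h.left_iff f).2 fun _ _ g hg =>
    ((h.left_iff u).1 hu g hg).of_comp_left (((h.left_iff v).1 hv g hg).of_iso i.symm)

/-- Fillers for pseudosquares with the opposite orientation of the invertible 2-cell. -/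
theorem BiOrthogonal.exists_filler_symm {A B X D : C} {f : A ⟶ B} {g : X ⟶ D}
    (h : BiOrthogonal f g) (p : A ⟶ X) (q : B ⟶ D) (e : f ≫ q ≅ p ≫ g) :
    ∃ (s : B ⟶ X) (l : f ≫ s ≅ p) (r : s ≫ g ≅ q),
      f ◁ r.hom ≫ e.hom = (α_ f s g).inv ≫ l.hom ▷ g := by
  obtain ⟨s, l, r, w⟩ := h.exists_filler p q e.symm
  refine ⟨s, l, r, ?_⟩
  rw [Iso.eq_inv_comp, ← reassoc_of% w]
  simp

/-- A morphism of pseudosquares with fixed left side induces a unique 2-cell between fillers. -/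
theorem BiOrthogonal.existsUnique_cell {A B X D : C} {f : A ⟶ B} {g : X ⟶ D}
    (h : BiOrthogonal f g) {p : A ⟶ X} {q₁ q₂ : B ⟶ D} {α₁ : f ≫ q₁ ≅ p ≫ g}
    {α₂ : f ≫ q₂ ≅ p ≫ g} {φ : q₁ ⟶ q₂} (hφ : f ◁ φ ≫ α₂.hom = α₁.hom) {s t : B ⟶ X}
    {l₁ : f ≫ s ≅ p} {r₁ : s ≫ g ≅ q₁} {l₂ : f ≫ t ≅ p} {r₂ : t ≫ g ≅ q₂}
    (hs : f ◁ r₁.hom ≫ α₁.hom = (α_ f s g).inv ≫ l₁.hom ▷ g)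
    (ht : f ◁ r₂.hom ≫ α₂.hom = (α_ f t g).inv ≫ l₂.hom ▷ g) :
    ∃! σ : s ⟶ t, f ◁ σ ≫ l₂.hom = l₁.hom ∧ σ ▷ g ≫ r₂.hom = r₁.hom ≫ φ := by
  -- The two required equations prescribe both whiskerings of `σ`, because `l₂` and `r₂` are
  -- invertible.
  obtain ⟨σ, a, b⟩ := h.exists_cell (l₁.hom ≫ l₂.inv) (r₁.hom ≫ φ ≫ r₂.inv) (by
    rw [← cancel_mono (f ◁ r₂.hom), ← cancel_mono α₂.hom]
    simp [hφ, hs, ht])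
  refine ⟨σ, ⟨by simp [a], by simp [b]⟩, fun τ hτ => h.cell_ext ?_ ?_⟩
  · rw [a, ← hτ.1]
    simp
  · rw [b, ← Category.assoc, ← hτ.2]
    simp

end Orthogonality

/-! ### Generic 1-cells and uniqueness of generic factorizations -/

section Generic

variable {A : Type u₁} [Bicategory.{w₁, v₁} A] {B : Type u₂} [Bicategory.{w₂, v₂} B]
variable {U : Pseudofunctor A B}

/-- The identity filler of a pseudosquare with equal sides. -/
@[simps]
def Filler.refl {b : B} {a a₂ : A} (n : b ⟶ U.obj a) (u : a ⟶ a₂) :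
    Filler U n (Iso.refl (n ≫ U.map u)) where
  w := 𝟙 a
  ν := whiskerLeftIso n (U.mapId a) ≪≫ ρ_ n
  ω := λ_ u
  paste := by simp

/-- Fillers of adjacent pseudosquares paste. -/
@[simps]
def Filler.trans {b : B} {a a₁ a₂ a₃ : A} {n : b ⟶ U.obj a} {n' : b ⟶ U.obj a₁}
    {f : b ⟶ U.obj a₂} {u : a ⟶ a₃} {u' : a₁ ⟶ a₃} {u'' : a₂ ⟶ a₃}
    {α : f ≫ U.map u'' ≅ n' ≫ U.map u'} {β : n' ≫ U.map u' ≅ n ≫ U.map u}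
    (s : Filler U n' α) (t : Filler U n β) : Filler U n (α ≪≫ β) where
  w := t.w ≫ s.w
  ν := whiskerLeftIso n (U.mapComp t.w s.w) ≪≫ (α_ n (U.map t.w) (U.map s.w)).symm ≪≫
    whiskerRightIso t.ν (U.map s.w) ≪≫ s.ν
  ω := α_ t.w s.w u'' ≪≫ whiskerLeftIso t.w s.ω ≪≫ t.ω
  paste := by
    have hs := s.paste
    have ht := t.paste
    simp only [Iso.trans_hom, comp_whiskerRight, Category.assoc]
    rw [reassoc_of% hs]
    simp only [whiskerLeftIso_hom, Iso.symm_hom, whiskerRightIso_hom]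
    rw [associator_naturality_left_assoc, ← whisker_exchange_assoc, ht]
    simp

/-- The uniqueness of fillers in the definition of a generic 1-cell follows from the existence and
uniqueness of 2-cells between fillers. -/
theorem IsGeneric.of_exists_unique_cell {b : B} {a : A} {n : b ⟶ U.obj a}
    (hfill : ∀ {a₁ a₂ : A} (f : b ⟶ U.obj a₁) (u : a₁ ⟶ a₂) (v : a ⟶ a₂)
      (α : f ≫ U.map u ≅ n ≫ U.map v), Nonempty (Filler U n α))
    (hcell : ∀ {a₁ a₂ : A} (f₁ f₂ : b ⟶ U.obj a₁) (u : a₁ ⟶ a₂) (v : a ⟶ a₂)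
      (α₁ : f₁ ≫ U.map u ≅ n ≫ U.map v) (α₂ : f₂ ≫ U.map u ≅ n ≫ U.map v) (φ : f₁ ⟶ f₂),
      φ ▷ U.map u ≫ α₂.hom = α₁.hom →
      ∀ (s : Filler U n α₁) (t : Filler U n α₂),
        ∃! σ : s.w ⟶ t.w, σ ▷ u ≫ t.ω.hom = s.ω.hom ∧
          n ◁ U.map₂ σ ≫ t.ν.hom = s.ν.hom ≫ φ) : IsGeneric U n where
  exists_filler := hfill
  exists_unique_cell := hcell
  filler_unique f u v α s t := by
    -- Taking `φ = 𝟙 f` gives 2-cells in both directions; their composites are compatible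
    -- endo-2-cells, hence identities by uniqueness.
    have cell (s t : Filler U n α) := hcell f f u v α α (𝟙 f) (by simp) s t
    simp only [Category.comp_id] at cell
    obtain ⟨σ, ⟨hσ₁, hσ₂⟩, hσ⟩ := cell s t
    obtain ⟨τ, ⟨hτ₁, hτ₂⟩, -⟩ := cell t s
    refine ⟨⟨σ, τ, (cell s s).unique ⟨?_, ?_⟩ ⟨?_, ?_⟩, (cell t t).unique ⟨?_, ?_⟩ ⟨?_, ?_⟩⟩,
      ⟨hσ₁, hσ₂⟩, fun ρ hρ => Iso.ext (hσ ρ.hom hρ)⟩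
    all_goals simp [hσ₁, hσ₂, hτ₁, hτ₂]

/-- Invertible 2-cells into the identity exist for self-fillers of a generic 1-cell. -/
theorem IsGeneric.nonempty_iso_id {b : B} {a a₂ : A} {n : b ⟶ U.obj a} (hn : IsGeneric U n)
    {u : a ⟶ a₂} {α : n ≫ U.map u ≅ n ≫ U.map u} (hα : α = Iso.refl _) (s : Filler U n α) :
    Nonempty (s.w ≅ 𝟙 a) := by
  -- The condition on `α` is an equation because pasted fillers lie over composites that are only
  -- propositionally the identity.
  subst hα
  exact ⟨(hn.filler_unique _ _ _ _ s (Filler.refl n u)).choose⟩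

/-- Two generic factorizations of the same 1-cell are equivalent. -/
theorem IsGeneric.nonempty_genericFactEquiv {b : B} {a m m' : A} {f : b ⟶ U.obj a}
    {n : b ⟶ U.obj m} {u : m ⟶ a} {n' : b ⟶ U.obj m'} {u' : m' ⟶ a} (hn : IsGeneric U n)
    (hn' : IsGeneric U n') (α : n ≫ U.map u ≅ f) (β : n' ≫ U.map u' ≅ f) :
    Nonempty (GenericFactEquiv U α β) := by
  -- Each factorization is filled against the other; both pasted composites are self-fillers, so
  -- `s.w` and `t.w` are mutually inverse up to isomorphism.
  obtain ⟨s⟩ := hn'.exists_filler n u u' (α ≪≫ β.symm)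
  obtain ⟨t⟩ := hn.exists_filler n' u' u (β ≪≫ α.symm)
  refine ⟨⟨s.w, ⟨t.w, hn'.nonempty_iso_id ?_ (t.trans s), hn.nonempty_iso_id ?_ (s.trans t)⟩,
    s.ν, s.ω, ?_⟩⟩
  · ext; simp
  · ext; simp
  · have h := s.paste
    simp only [Iso.trans_hom, Iso.symm_hom] at h
    rw [← cancel_mono β.inv, ← cancel_epi (n' ◁ (U.mapComp s.w u).inv),
      ← cancel_epi (α_ n' (U.map s.w) (U.map u)).hom]
    simp only [Category.assoc, Iso.hom_inv_id, Category.comp_id]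
    rw [← whiskerLeft_comp, ← h]
    simp

/-- The filler underlying an equivalence of factorizations. -/
@[simps]
def GenericFactEquiv.filler {b : B} {a m m' : A} {f : b ⟶ U.obj a}
    {n : b ⟶ U.obj m} {u : m ⟶ a} {n' : b ⟶ U.obj m'} {u' : m' ⟶ a} {α : n ≫ U.map u ≅ f}
    {β : n' ≫ U.map u' ≅ f} (c : GenericFactEquiv U α β) : Filler U n' (α ≪≫ β.symm) where
  w := c.e
  ν := c.ν
  ω := c.ω
  paste := by
    rw [← cancel_mono β.hom]
    simp [c.paste]

variable (U) in
/-- A pseudofunctor is bistable as soon as every 1-cell has a generic factorization. -/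
theorem isBistable_of_exists_generic
    (h : ∀ {b : B} {a : A} (f : b ⟶ U.obj a), ∃ (m : A) (n : b ⟶ U.obj m) (u : m ⟶ a),
      Nonempty (n ≫ U.map u ≅ f) ∧ IsGeneric U n) : IsBistable U := by
  intro b a f
  obtain ⟨m, n, u, ⟨α⟩, hn⟩ := h f
  exact ⟨m, n, u, α, hn, fun m' n' u' β hn' => ⟨hn.nonempty_genericFactEquiv hn' α β,
    fun c d => hn'.filler_unique _ _ _ _ c.filler d.filler⟩⟩

end Generic

/-! ### Genericity and bistability for duals of inclusions -/

section OpInclusion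

open Bicategory.Opposite

variable {C : Type u} [Bicategory.{w, v} C] {S : SubData C}

/-- The invertible 2-cell underlying an invertible 2-cell of a sub-bicategory. -/
@[simps]
def Sub.isoCell {X Y : Sub S} {f g : X ⟶ Y} (e : f ≅ g) : Sub.Hom.hom f ≅ Sub.Hom.hom g where
  hom := e.hom.cell
  inv := e.inv.cell
  hom_inv_id := congrArg Sub.Hom₂.cell e.hom_inv_id
  inv_hom_id := congrArg Sub.Hom₂.cell e.inv_hom_id

/-- The equation of 2-cells expressing the pasting condition of a filler for the opposite of the
inclusion of a sub-bicategory. -/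
theorem Filler.op_incl_paste {b : Cᵒᵖ} {a a₁ a₂ : (Sub S)ᵒᵖ}
    {n : b ⟶ (opPseudofunctor (Sub.incl S)).obj a}
    {f : b ⟶ (opPseudofunctor (Sub.incl S)).obj a₁} {u : a₁ ⟶ a₂} {v : a ⟶ a₂}
    {α : f ≫ (opPseudofunctor (Sub.incl S)).map u ≅ n ≫ (opPseudofunctor (Sub.incl S)).map v}
    (s : Filler (opPseudofunctor (Sub.incl S)) n α) :
    Sub.Hom.hom u.unop ◁ s.ν.hom.unop2 ≫ α.hom.unop2 =
      (α_ (Sub.Hom.hom u.unop) (Sub.Hom.hom s.w.unop) n.unop).inv ≫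
        s.ω.hom.unop2.cell ▷ n.unop := by
  -- The identity factor is the inverse compositor of the strict inclusion.
  have h : Sub.Hom.hom u.unop ◁ s.ν.hom.unop2 ≫ α.hom.unop2 =
      (α_ (Sub.Hom.hom u.unop) (Sub.Hom.hom s.w.unop) n.unop).inv ≫
        (𝟙 _ ≫ s.ω.hom.unop2.cell) ▷ n.unop := congrArg Hom2.unop2 s.paste
  rwa [Category.id_comp] at h

/-- A 1-cell right bi-orthogonal to a right cancellative class of 1-cells is generic for the
opposite of the inclusion of a sub-bicategory on that class. -/
theorem isGeneric_op_incl {b : C} {a : Sub S} (n : a.obj ⟶ b)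
    (horth : ∀ {X Y : C} (u : X ⟶ Y), S.homProp u → BiOrthogonal u n)
    (hcancel : ∀ {X Y Z : C} {u : X ⟶ Y} {f : Y ⟶ Z} {v : X ⟶ Z}, (u ≫ f ≅ v) →
      S.homProp u → S.homProp v → S.homProp f) :
    IsGeneric (opPseudofunctor (Sub.incl S)) (b := op b) (a := op a) n.op := by
  refine IsGeneric.of_exists_unique_cell ?_ ?_
  · intro a₁ a₂ f u v α
    -- In `C` the square reads `u ≫ f ≅ v ≫ n`. Its diagonal `s` satisfies `u ≫ s ≅ v` with `u` and
    -- `v` selected, so cancellation makes `s` selected too.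
    obtain ⟨s, l, r, h⟩ := (horth (Sub.Hom.hom u.unop) (Sub.Hom.property u.unop)).exists_filler_symm
      (Sub.Hom.hom v.unop) f.unop α.unop2
    let w : a₁.unop ⟶ a := ⟨s, hcancel l (Sub.Hom.property u.unop) (Sub.Hom.property v.unop)⟩
    let l' : u.unop ≫ w ≅ v.unop := Sub.isoMk l
    exact ⟨⟨w.op, r.op2, l'.op2, congrArg op2
      (h.trans (congrArg (fun x => _ ≫ x ▷ n) (Category.id_comp l.hom).symm))⟩⟩
  · intro a₁ a₂ f₁ f₂ u v α₁ α₂ φ hφ s t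
    obtain ⟨σ, ⟨hσ₁, hσ₂⟩, hσ⟩ := (horth (Sub.Hom.hom u.unop)
      (Sub.Hom.property u.unop)).existsUnique_cell (α₁ := α₁.unop2) (α₂ := α₂.unop2)
      (φ := φ.unop2) (congrArg Hom2.unop2 hφ)
      (l₁ := (Sub.isoCell s.ω.unop2)) (r₁ := s.ν.unop2) (l₂ := Sub.isoCell t.ω.unop2)
      (r₂ := t.ν.unop2) s.op_incl_paste t.op_incl_paste
    exact ⟨op2 ⟨σ⟩, ⟨congrArg op2 (Sub.hom₂_ext hσ₁), congrArg op2 hσ₂⟩, fun τ hτ =>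
      congrArg op2 (Sub.hom₂_ext (hσ τ.unop2.cell
        ⟨congrArg (fun x => Sub.Hom₂.cell (Hom2.unop2 x)) hτ.1, congrArg Hom2.unop2 hτ.2⟩))⟩

/-- If every 1-cell out of an object of a sub-bicategory factors as a 1-cell of the sub-bicategory
followed by a 1-cell right bi-orthogonal to its 1-cells, and the latter are right cancellative, then
the opposite of the inclusion is bistable. -/
theorem isBistable_op_incl
    (hfact : ∀ {a b : C} (f : a ⟶ b), S.objProp a → ∃ (m : C) (l : a ⟶ m) (r : m ⟶ b),
      Nonempty (l ≫ r ≅ f) ∧ S.objProp m ∧ S.homProp l ∧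
        ∀ {X Y : C} (u : X ⟶ Y), S.homProp u → BiOrthogonal u r)
    (hcancel : ∀ {X Y Z : C} {u : X ⟶ Y} {f : Y ⟶ Z} {v : X ⟶ Z}, (u ≫ f ≅ v) →
      S.homProp u → S.homProp v → S.homProp f) :
    IsBistable (opPseudofunctor (Sub.incl S)) := by
  refine isBistable_of_exists_generic _ fun {b a} f => ?_
  obtain ⟨m, l, r, ⟨α⟩, hm, hl, hr⟩ := hfact f.unop a.unop.property
  let m' : Sub S := ⟨m, hm⟩
  let l' : a.unop ⟶ m' := ⟨l, hl⟩
  exact ⟨op m', r.op, l'.op, ⟨α.op2⟩, isGeneric_op_incl (a := m') r hr hcancel⟩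

end OpInclusion

/-! ### Lifting bi-orthogonality to pseudoslices -/

section Slice

variable {C : Type u} [Bicategory.{w, v} C] {X : C}

/-- The invertible 2-cell underlying an invertible 2-cell of a pseudoslice. -/
@[simps]
def PseudoSlice.isoCell {a b : PseudoSlice X} {f g : a ⟶ b} (e : f ≅ g) :
    PseudoSlice.Hom.hom f ≅ PseudoSlice.Hom.hom g where
  hom := e.hom.cell
  inv := e.inv.cell
  hom_inv_id := congrArg PseudoSlice.Hom₂.cell e.hom_inv_id
  inv_hom_id := congrArg PseudoSlice.Hom₂.cell e.inv_hom_id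

/-- 1-cells of a pseudoslice whose underlying 1-cells are bi-orthogonal are bi-orthogonal. -/
theorem PseudoSlice.biOrthogonal {a b x d : PseudoSlice X} {f : a ⟶ b} {g : x ⟶ d}
    (h : BiOrthogonal (PseudoSlice.Hom.hom f) (PseudoSlice.Hom.hom g)) : BiOrthogonal f g := by
  refine BiOrthogonal.mk ?_ ?_ ?_
  · intro p q e
    obtain ⟨s, l, r, w⟩ := h.exists_filler (Hom.hom p) (Hom.hom q) (isoCell e)
    -- This triangle is forced by requiring `r` to be a 2-cell of the pseudoslice; what remains is
    -- the compatibility of `l`.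
    let s' : b ⟶ x := ⟨s, whiskerLeftIso s (Hom.iso g).symm ≪≫ (α_ _ _ _).symm ≪≫
      whiskerRightIso r d.str ≪≫ Hom.iso q⟩
    have he := e.hom.w
    refine ⟨s', isoMk l ?_, isoMk r ?_, hom₂_ext w⟩
    -- The compatibility of `e` with the triangles, solved for the triangle of `p`.
    · have hp : (Hom.iso p).hom = Hom.hom p ◁ (Hom.iso g).inv ≫ (α_ _ _ _).inv ≫
          e.hom.cell ▷ d.str ≫ (α_ _ _ _).hom ≫ Hom.hom f ◁ (Hom.iso q).hom ≫
            (Hom.iso f).hom := by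
        rw [← cancel_epi (Hom.hom p ◁ (Hom.iso g).hom), ← cancel_epi (α_ _ _ _).hom]
        simpa using he.symm
      have w' := congrArg (fun x => x ▷ d.str) w
      simp only [comp_whiskerRight, isoCell_hom] at w'
      rw [hp, ← whisker_exchange_assoc, associator_inv_naturality_left_assoc, reassoc_of% w']
      simp [s']
    · simp [s']
  · intro s t φ ψ e
    obtain ⟨σ, hσ₁, hσ₂⟩ := h.exists_cell φ.cell ψ.cell (congrArg Hom₂.cell e)
    refine ⟨⟨σ, ?_⟩, hom₂_ext hσ₁, hom₂_ext hσ₂⟩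
    -- The structure map of `x` is isomorphic to `g ≫ d.str`, so the triangle condition on `σ`
    -- reduces to that on `σ ▷ g = ψ`.
    have hψ := ψ.w
    rw [← hσ₂] at hψ
    rw [← cancel_epi (Hom.hom s ◁ (Hom.iso g).hom), whisker_exchange_assoc,
      ← cancel_epi (α_ _ _ _).hom]
    simpa using hψ
  · intro s t σ τ h₁ h₂
    exact hom₂_ext (h.cell_ext (congrArg Hom₂.cell h₁) (congrArg Hom₂.cell h₂))

end Slice

end BiStab

/-! ### Bistability of the inclusions of left objects -/

theorem mainTheorem4 {C : Type u} [Bicategory.{w, v} C] (L R : MorphismProperty C)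
    (hLR : BiStab.IsBifactorizationSystem L R) (L' : MorphismProperty C) (hL' : L' ≤ L)
    (hcancel : BiStab.HasRightCancellationAlong L' L) :
    (∀ T : C, BiStab.IsBiterminal T → (∀ X : C, L' (𝟙 X)) →
      BiStab.IsBistable
        (BiStab.opPseudofunctor (BiStab.Sub.incl (BiStab.leftObj hLR L' T)))) ∧
    (∀ X : C,
      BiStab.IsBistable
        (BiStab.opPseudofunctor (BiStab.Sub.incl (BiStab.leftObjOver hLR L' X)))) := by
  refine ⟨fun T hT _ => BiStab.isBistable_op_incl ?_ fun i hu hv => hLR.left_cancel i hu hv,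
    fun X => BiStab.isBistable_op_incl ?_
      fun i hu hv => hLR.left_cancel (BiStab.PseudoSlice.isoCell i) hu hv⟩
  · rintro a b f ⟨t, ht⟩
    obtain ⟨m, l, r, α, hl, hr, -⟩ := hLR.factorization f
    obtain ⟨E⟩ := hT m
    obtain ⟨E'⟩ := hT a
    let t' : m ⟶ T := E.inverse.obj ⟨⟨⟩⟩
    -- Any two 1-cells into `T` are isomorphic, since `E'` is fully faithful into a terminal
    -- category.
    have i : l ≫ t' ≅ t := E'.functor.preimageIso (eqToIso (Subsingleton.elim _ _))
    exact ⟨m, l, r, ⟨α⟩, ⟨t', hcancel l t' t ⟨i⟩ ht hl⟩, hl,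
      fun u hu => (hLR.right_iff r).1 hr u hu⟩
  · intro a b f ha
    obtain ⟨m, l, r, α, hl, hr, -⟩ := hLR.factorization (BiStab.PseudoSlice.Hom.hom f)
    let i : l ≫ r ≫ b.str ≅ a.str :=
      (α_ _ _ _).symm ≪≫ whiskerRightIso α b.str ≪≫ BiStab.PseudoSlice.Hom.iso f
    let m' : BiStab.PseudoSlice X := ⟨m, r ≫ b.str⟩
    -- The structure map `r ≫ b.str` makes the triangle of `r` an identity; that of `l` is then `i`,
    -- which also feeds the cancellation of `L'`.
    let l' : a ⟶ m' := ⟨l, i⟩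
    let r' : m' ⟶ b := ⟨r, Iso.refl _⟩
    refine ⟨m', l', r', ⟨BiStab.PseudoSlice.isoMk α ?_⟩, hcancel l _ _ ⟨i⟩ ha hl, hl,
      fun u hu => BiStab.PseudoSlice.biOrthogonal ((hLR.right_iff r).1 hr _ hu)⟩
    simp [l', r', i]
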